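/- **Setting.** Let $n,d,K,\bar K,k$ be positive integers with $\bar K\le K$, and let $\varepsilon_0,\delta>0$ and $0<c_{low}<c_{up}$. *Dataset.* Input/label pairs $(x_i,y_i)_{i=1}^n\subset\mathbb R^d\times\mathbb R$ form an $(\varepsilon_0,\delta)$ clusterable dataset: $\|x_i\|_2=1$; there are unit vectors (cluster centers) $c_1,\dots,c_K\in\mathbb R^d$ and each $i$ belongs to one cluster $\ell(i)\in\{1,\dots,K\}$, with $\|x_i-c_{\ell(i)}\|_2\le\varepsilon_0$; the number $n_\ell$ of points in cluster $\ell$ satisfies $c_{low}\frac nK\le n_\ell\le c_{up}\frac nK$ for every $\ell$; each cluster belongs to one of $\bar K$ classes, class $r$ has a label $\alpha_r\in[-1,1]$, $y_i$ is the label of the class of cluster $\ell(i)$, $|\alpha_r-\alpha_s|\ge\delta$ for $r\ne s$, and $\|c_\ell-c_{\ell'}\|_2\ge 2\varepsilon_0$ whenever the clusters $\ell,\ell'$ belong to different classes. Let $C\in\mathbb R^{K\times d}$ have rows $c_1,\dots,c_K$, let $\tilde x_i=c_{\ell(i)}$ be the clean inputs and $\tilde X\in\mathbb R^{n\times d}$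 the matrix with rows $\tilde x_1,\dots,\tilde x_n$. The support subspace is $$\mathcal S_+=\{u\in\mathbb R^n:\ u_{i_1}=u_{i_2}\text{ whenever }\tilde x_{i_1}=\tilde x_{i_2}=c_\ell\text{ for some }1\le\ell\le K\}.$$ *Network.* Consider $x\mapsto v^T\phi(Wx)$ with $W\in\mathbb R^{k\times d}$, where half of the entries of $v\in\mathbb R^k$ equal $1/\sqrt k$ and the other half $-1/\sqrt k$ (for odd $k$, one entry is $0$ and the remaining ones are split evenly). The activation $\phi:\mathbb R\to\mathbb R$ is twice differentiable with $|\phi'(z)|,|\phi''(z)|\le\Gamma$ for all $z$. The Jacobian with respect to $W$ at an input matrix $X\in\mathbb R^{n\times d}$ is $\mathcal J(W,X)\in\mathbb R^{n\times kd}$ given by $\mathcal J(W,X)^T=(\mathrm{diag}(v)\,\phi'(WX^T))*X^T$, where $*$ is the (column-wise) Khatri–Rao product; i.e. the entry of $\mathcal J(W,X)$ in row $i$ and column $(j,l)$ is $v_j\,\phi'((WX^T)_{ji})\,X_{il}$. Let $\lambda(C)$ be the minimum eigenvalue of $\Sigma(C)=(CC^T)\odot\mathbb E_{g\sim\mathcal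 N(0,I_d)}[\phi'(Cg)\phi'(Cg)^T]$, where $\odot$ is the entrywise product, and assume $\lambda(C)>0$. Write $\|\cdot\|$ for the spectral norm and $\|\cdot\|_F$ for the Frobenius norm, and for $M\in\mathbb R^{n\times p}$ and a subspace $\mathcal S\subset\mathbb R^n$ put $$\sigma_{\min}(M,\mathcal S)=\inf\{\|v^TU^TM\|_2:\ U\in\mathbb R^{n\times\dim\mathcal S},\ UU^T=P_{\mathcal S},\ v\in\mathbb R^{\dim\mathcal S},\ \|v\|_2=1\},$$ where $P_{\mathcal S}$ is the orthogonal projection onto $\mathcal S$. **Theorem (Jacobian Properties at Clusterable Dataset).** There is an absolute constant $c>0$ such that, in every setting as above, the following hold. 1. For all $\widetilde W,W\in\mathbb R^{k\times d}$, $$\|\mathcal J(\widetilde W,\tilde X)-\mathcal J(W,\tilde X)\|\le\Gamma\sqrt{\frac{c_{up}n}{kK}}\,\|C\|\,\|\widetilde W-W\|_F.$$ 2. For all $W\in\mathbb R^{k\times d}$, $\ \|\mathcal J(W,\tilde X)\|\le\sqrt{\frac{c_{up}n}{K}}\,\Gamma\,\|C\|$. 3. If $k\ge c\,\dfrac{\Gamma^2\log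 K\,\|C\|^2}{\lambda(C)}$ and $W_0\in\mathbb R^{k\times d}$ has i.i.d. $\mathcal N(0,1)$ entries, then with probability at least $1-1/K^{100}$, $$\sigma_{\min}(\mathcal J(W_0,\tilde X),\mathcal S_+)\ge\sqrt{\frac{c_{low}\,n\,\lambda(C)}{2K}}.$$ 4. For all $W\in\mathbb R^{k\times d}$, $\ \mathrm{range}(\mathcal J(W,\tilde X))\subset\mathcal S_+$. -/

import Mathlib

open scoped Matrix
open MeasureTheory ProbabilityTheory

noncomputable section

namespace ClusterNet

/-- Spectral norm (largest singular value) of a real matrix: its operator norm between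
Euclidean spaces. -/
def specNorm {m p : Type*} [Fintype m] [Fintype p] [DecidableEq p] (M : Matrix m p ℝ) : ℝ :=
  ‖LinearMap.toContinuousLinearMap (Matrix.toEuclideanLin M)‖

/-- Frobenius norm of a real matrix. -/
def frobNorm {m p : Type*} [Fintype m] [Fintype p] (M : Matrix m p ℝ) : ℝ :=
  √(∑ i, ∑ j, M i j ^ 2)

/-- An `(ε₀, δ)` clusterable dataset of `n` input/label pairs in `ℝᵈ × ℝ`, with `K` clusters,
`Kbar` classes and balancedness constants `cLow`, `cUp`. -/
structure ClusterableDataset (n d K Kbar : ℕ) (ε₀ δ cLow cUp : ℝ) where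
  /-- the inputs -/
  x : Fin n → EuclideanSpace ℝ (Fin d)
  /-- the labels -/
  y : Fin n → ℝ
  /-- the cluster centers -/
  center : Fin K → EuclideanSpace ℝ (Fin d)
  /-- the cluster to which a data point belongs -/
  cluster : Fin n → Fin K
  /-- the label values of the classes -/
  classLabel : Fin Kbar → ℝ
  /-- the class to which a cluster belongs -/
  classOf : Fin K → Fin Kbar
  noise_pos : 0 < ε₀
  sep_pos : 0 < δ
  cLow_pos : 0 < cLow
  cLow_lt_cUp : cLow < cUp
  classes_le : Kbar ≤ K
  norm_x : ∀ i, ‖x i‖ = 1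
  norm_center : ∀ l, ‖center l‖ = 1
  card_lower : ∀ l, cLow * (n / K) ≤ ((Finset.univ.filter fun i => cluster i = l).card : ℝ)
  card_upper : ∀ l, ((Finset.univ.filter fun i => cluster i = l).card : ℝ) ≤ cUp * (n / K)
  dist_center : ∀ i, ‖x i - center (cluster i)‖ ≤ ε₀
  classLabel_mem : ∀ r, classLabel r ∈ Set.Icc (-1 : ℝ) 1
  label_eq : ∀ i, y i = classLabel (classOf (cluster i))
  label_sep : ∀ r s, r ≠ s → δ ≤ |classLabel r - classLabel s|
  center_sep : ∀ l l', classOf l ≠ classOf l' → 2 * ε₀ ≤ ‖center l - center l'‖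

namespace ClusterableDataset

variable {n d K Kbar : ℕ} {ε₀ δ cLow cUp : ℝ} (D : ClusterableDataset n d K Kbar ε₀ δ cLow cUp)

/-- The matrix `C` whose rows are the cluster centers. -/
def centerMatrix : Matrix (Fin K) (Fin d) ℝ := Matrix.of fun l j => D.center l j

/-- The clean inputs: every data point is replaced by the center of its cluster. -/
def clean (i : Fin n) : EuclideanSpace ℝ (Fin d) := D.center (D.cluster i)

/-- The clean input matrix, with the clean inputs as rows. -/
def cleanMatrix : Matrix (Fin n) (Fin d) ℝ := Matrix.of fun i j => D.clean i j

/-- The support subspace: vectors in `ℝⁿ` that are constant on every set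
`{i | clean i = center l}`. -/
def supportSpace : Submodule ℝ (EuclideanSpace ℝ (Fin n)) where
  carrier := {u | ∀ l i₁ i₂, D.clean i₁ = D.center l → D.clean i₂ = D.center l → u i₁ = u i₂}
  add_mem' := by
    intro a b ha hb l i₁ i₂ h₁ h₂
    simp [ha l i₁ i₂ h₁ h₂, hb l i₁ i₂ h₁ h₂]
  zero_mem' := by
    intro l i₁ i₂ _ _
    simp
  smul_mem' := by
    intro c a ha l i₁ i₂ h₁ h₂
    simp [ha l i₁ i₂ h₁ h₂]

end ClusterableDataset

/-- The output weights: half of the entries are `1/√k` and the other half are `-1/√k`; if `k` is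
odd, the remaining entry is zero. -/
def IsOutputWeights {k : ℕ} (v : Fin k → ℝ) : Prop :=
  (Finset.univ.filter fun j => v j = 1 / √(k : ℝ)).card = k / 2 ∧
  (Finset.univ.filter fun j => v j = -(1 / √(k : ℝ))).card = k / 2 ∧
  (Finset.univ.filter fun j => v j = 0).card = k % 2

/-- The (column-wise) Khatri-Rao product of two matrices with the same number of columns. -/
def khatriRao {m p q : Type*} (A : Matrix m q ℝ) (B : Matrix p q ℝ) : Matrix (m × p) q ℝ :=
  Matrix.of fun jl i => A jl.1 i * B jl.2 i

/-- The Jacobian `J(W, X)` of the network `x ↦ vᵀ φ(W x)` with respect to `W` at the inputs given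
by the rows of `X`: `J(W, X)ᵀ = (diag(v) φ'(W Xᵀ)) * Xᵀ`, where `*` is the Khatri-Rao product. -/
def jacobian {n d k : ℕ} (φ : ℝ → ℝ) (v : Fin k → ℝ) (W : Matrix (Fin k) (Fin d) ℝ)
    (X : Matrix (Fin n) (Fin d) ℝ) : Matrix (Fin n) (Fin k × Fin d) ℝ :=
  (khatriRao (Matrix.diagonal v * (W * Xᵀ).map (deriv φ)) Xᵀ)ᵀ

/-- The neural net covariance `Σ(C) = (C Cᵀ) ⊙ 𝔼[φ'(C g) φ'(C g)ᵀ]`, `g ∼ N(0, I_d)`. -/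
def netCov {d K : ℕ} (φ : ℝ → ℝ) (C : Matrix (Fin K) (Fin d) ℝ) : Matrix (Fin K) (Fin K) ℝ :=
  (C * Cᵀ).hadamard (Matrix.of fun l l' =>
    ∫ g : Fin d → ℝ, deriv φ ((C *ᵥ g) l) * deriv φ ((C *ᵥ g) l')
      ∂(Measure.pi fun _ => gaussianReal 0 1))

theorem netCov_isHermitian {d K : ℕ} (φ : ℝ → ℝ) (C : Matrix (Fin K) (Fin d) ℝ) :
    (netCov φ C).IsHermitian := by
  ext l l'
  simp only [netCov, Matrix.conjTranspose_apply, Matrix.hadamard_apply, Matrix.of_apply,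
    Matrix.mul_apply, Matrix.transpose_apply, star_trivial]
  congr 1
  · exact Finset.sum_congr rfl fun _ _ => mul_comm _ _
  · congr 1
    funext g
    exact mul_comm _ _

/-- `λ(C)`, the minimum eigenvalue of `Σ(C)`. -/
def lam {d K : ℕ} (φ : ℝ → ℝ) (C : Matrix (Fin K) (Fin d) ℝ) : ℝ :=
  ⨅ l, (netCov_isHermitian φ C).eigenvalues l

/-- The minimum singular value of `M` over the subspace `S`: the minimum of `‖vᵀ Uᵀ M‖` over unit
vectors `v` and matrices `U` with `dim S` columns such that `U Uᵀ` is the orthogonal projection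
onto `S`. -/
def sigmaMinOn {n : ℕ} {p : Type*} [Fintype p] (M : Matrix (Fin n) p ℝ)
    (S : Submodule ℝ (EuclideanSpace ℝ (Fin n))) : ℝ :=
  sInf {r | ∃ (U : Matrix (Fin n) (Fin (Module.finrank ℝ S)) ℝ)
    (v : EuclideanSpace ℝ (Fin (Module.finrank ℝ S))),
    Matrix.toEuclideanCLM (𝕜 := ℝ) (U * Uᵀ) = S.starProjection ∧ ‖v‖ = 1 ∧
      r = ‖(WithLp.toLp 2 ((v : Fin (Module.finrank ℝ S) → ℝ) ᵥ* (Uᵀ * M)) :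
        EuclideanSpace ℝ p)‖}

/-- The law of a `k × d` random matrix with i.i.d. `N(0, 1)` entries. -/
def gaussianInit (k d : ℕ) : Measure (Fin k → Fin d → ℝ) :=
  Measure.pi fun _ => Measure.pi fun _ => gaussianReal 0 1

end ClusterNet

end

open scoped Matrix
open MeasureTheory ProbabilityTheory

noncomputable section

/-! On clean inputs, row `i` of the Jacobian depends only on the center `c_l` of its cluster, and
its block for neuron `j` is `v_j φ'(⟨c_l, w_j⟩) c_l`. Hence the range lies in the support subspace.
Passing from data points to clusters multiplies squared norms by at most `cUp n / K`, and
Cauchy-Schwarz over the neurons then yields both norm bounds through `specNorm_le_of_entries`; for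
the difference, `φ'` is `Γ`-Lipschitz and the centers are unit vectors.

For the smallest singular value, let `b` collect the sums of `u ∈ S_+` over the clusters. Since `u`
is constant on clusters, `‖b‖² ≥ (cLow n / K) ‖u‖²` (`card_mul_sum_sq_le`), and `‖uᵀJ‖² = ∑ v_j² bᵀ
H(w_j) b` (`sum_vecMul_jacobian_sq`). Here `H(g)` is the Gram matrix of `neuronJacobian` at `g`:
positive semidefinite, at most `Γ²‖C‖²`, with Gaussian mean `Σ(C) ⪰ λ(C)`. It remains to show that
`∑ k v_j² H(w_j) ⪰ k λ(C) / 2` with high probability.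

This is `matrix_chernoff_lower`, proved by the Ahlswede-Winter method: bound the expected trace of
`exp (-θ ∑ H)`, splitting off one independent summand at a time with the Golden-Thompson inequality
`trace_exp_add_le`. That inequality follows from the Lie-Trotter formula and the trace inequalities
for powers of two in `trace_pow_two_pow_le_and`. -/

namespace ClusterNet

/-! ### The Lie-Trotter product formula. -/

section LieTrotter

open Filter Topology NormedSpace

theorem norm_exp_le_exp_norm {A : Type*} [NormedRing A] [NormOneClass A] [NormedAlgebra ℝ A]
    (x : A) : ‖exp x‖ ≤ Real.exp ‖x‖ := by
  rw [exp_eq_tsum ℝ]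
  refine tsum_of_norm_bounded (g := fun n => ((n.factorial : ℝ)⁻¹) * ‖x‖ ^ n) ?_ fun n => ?_
  · rw [Real.exp_eq_exp_ℝ]
    simpa using exp_series_hasSum_exp' (𝕂 := ℝ) ‖x‖
  · rw [norm_smul, norm_inv, RCLike.norm_natCast]
    gcongr
    exact norm_pow_le x n

/-- Telescoping the difference of powers; `1 ≤ M` allows every power of `M` to be rounded up to `M ^
n`. -/
theorem norm_pow_sub_pow_le {A : Type*} [NormedRing A] [NormOneClass A] {p q : A} {M : ℝ}
    (hM : 1 ≤ M) (hp : ‖p‖ ≤ M) (hq : ‖q‖ ≤ M) (n : ℕ) :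
    ‖p ^ n - q ^ n‖ ≤ n * M ^ n * ‖p - q‖ := by
  have hM0 : 0 ≤ M := by linarith
  induction n with
  | zero => simp
  | succ n ih =>
    have h : p ^ (n + 1) - q ^ (n + 1) = p ^ n * (p - q) + (p ^ n - q ^ n) * q := by
      rw [pow_succ, pow_succ]; noncomm_ring
    have h1 : ‖p ^ n * (p - q)‖ ≤ M ^ (n + 1) * ‖p - q‖ := by
      refine (norm_mul_le _ _).trans ?_
      gcongr
      refine (norm_pow_le p n).trans ((pow_le_pow_left₀ (norm_nonneg _) hp n).trans ?_)
      exact pow_le_pow_right₀ hM n.le_succ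
    have h2 : ‖(p ^ n - q ^ n) * q‖ ≤ n * M ^ n * ‖p - q‖ * M := by
      refine (norm_mul_le _ _).trans ?_
      gcongr
    rw [h]
    refine (norm_add_le _ _).trans ((add_le_add h1 h2).trans_eq ?_)
    push_cast
    ring

/-- The **Lie-Trotter product formula**. -/
theorem tendsto_exp_mul_exp_pow {A : Type*} [NormedRing A] [NormOneClass A] [NormedAlgebra ℝ A]
    [CompleteSpace A] (a b : A) :
    Tendsto (fun n : ℕ => (exp ((n : ℝ)⁻¹ • a) * exp ((n : ℝ)⁻¹ • b)) ^ n) atTop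
      (𝓝 (exp (a + b))) := by
  -- The two exponentials agree to first order at `0`, so `n * ‖g (1/n)‖` tends to `0`; this beats
  -- the factor `n` lost in telescoping, because `M ^ n = c` does not depend on `n`.
  set g : ℝ → A := fun t => exp (t • a) * exp (t • b) - exp (t • (a + b)) with hg
  have hder : HasDerivAt g 0 0 := by
    have h := ((hasDerivAt_exp_smul_const (𝕂 := ℝ) a 0).mul
      (hasDerivAt_exp_smul_const (𝕂 := ℝ) b 0)).sub
      (hasDerivAt_exp_smul_const (𝕂 := ℝ) (a + b) 0)
    refine (h.congr_deriv ?_)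
    simp
  have hinv : Tendsto (fun n : ℕ => (n : ℝ)⁻¹) atTop (𝓝[≠] 0) :=
    (tendsto_inv_atTop_nhdsGT_zero.comp tendsto_natCast_atTop_atTop).mono_right
      (nhdsWithin_mono _ fun x hx => (ne_of_gt hx))
  have hlim : Tendsto (fun n : ℕ => (n : ℝ) * ‖g ((n : ℝ)⁻¹)‖) atTop (𝓝 0) := by
    have h := (hasDerivAt_iff_tendsto_slope_zero.1 hder).comp hinv |>.norm
    simpa [hg, norm_smul, Function.comp_def] using h
  set c : ℝ := Real.exp (‖a‖ + ‖b‖) with hc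
  have key : ∀ᶠ n : ℕ in atTop,
      ‖(exp ((n : ℝ)⁻¹ • a) * exp ((n : ℝ)⁻¹ • b)) ^ n - exp (a + b)‖
        ≤ c * ((n : ℝ) * ‖g ((n : ℝ)⁻¹)‖) := by
    filter_upwards [eventually_gt_atTop 0] with n hn
    have hn0 : (n : ℝ) ≠ 0 := by positivity
    set M : ℝ := Real.exp ((n : ℝ)⁻¹ * (‖a‖ + ‖b‖))
    have hM : M ^ n = c := by
      rw [← Real.exp_nat_mul, ← mul_assoc, mul_inv_cancel₀ hn0, one_mul]
    have hq : exp ((n : ℝ)⁻¹ • (a + b)) ^ n = exp (a + b) := by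
      let _ : NormedAlgebra ℚ A := NormedAlgebra.restrictScalars ℚ ℝ A
      rw [← exp_nsmul, ← Nat.cast_smul_eq_nsmul ℝ, smul_smul, mul_inv_cancel₀ hn0, one_smul]
    have nrm : ∀ x : A, ‖exp ((n : ℝ)⁻¹ • x)‖ ≤ Real.exp ((n : ℝ)⁻¹ * ‖x‖) := fun x => by
      refine (norm_exp_le_exp_norm _).trans_eq ?_
      rw [norm_smul, norm_inv, RCLike.norm_natCast]
    have h := norm_pow_sub_pow_le (p := exp ((n : ℝ)⁻¹ • a) * exp ((n : ℝ)⁻¹ • b))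
      (q := exp ((n : ℝ)⁻¹ • (a + b))) (M := M) (Real.one_le_exp (by positivity)) ?_ ?_ n
    · rw [hq, hM] at h
      refine h.trans_eq ?_
      rw [hg]; ring
    · refine (norm_mul_le _ _).trans ?_
      refine (mul_le_mul (nrm a) (nrm b) (norm_nonneg _) (Real.exp_pos _).le).trans_eq ?_
      rw [← Real.exp_add, ← mul_add]
    · refine (nrm _).trans (Real.exp_le_exp.2 ?_)
      gcongr
      exact norm_add_le _ _
  rw [tendsto_iff_norm_sub_tendsto_zero]
  refine squeeze_zero' (Eventually.of_forall fun _ => norm_nonneg _) key ?_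
  simpa using hlim.const_mul c

end LieTrotter

/-! ### Trace inequalities for powers, and Golden-Thompson. -/

section GoldenThompson

theorem trace_mul_pow_comm {m : Type*} [Fintype m] [DecidableEq m]
    (A B : Matrix m m ℝ) (n : ℕ) :
    ((A * B) ^ n).trace = ((B * A) ^ n).trace := by
  cases n with
  | zero => simp
  | succ n =>
    have h : ∀ n : ℕ, (A * B) ^ (n + 1) = A * ((B * A) ^ n * B) := by
      intro n
      induction n with
      | zero => simp
      | succ n ih =>
        rw [pow_succ, ih, pow_succ]
        simp only [mul_assoc]
    rw [h, Matrix.trace_mul_comm, mul_assoc, ← pow_succ]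

theorem trace_self_mul_transpose_nonneg {m : Type*} [Fintype m]
    (X : Matrix m m ℝ) : 0 ≤ (X * Xᵀ).trace := by
  simpa using (Matrix.posSemidef_self_mul_conjTranspose X).trace_nonneg

theorem trace_sq_le {m : Type*} [Fintype m] [DecidableEq m]
    (X : Matrix m m ℝ) : (X ^ 2).trace ≤ (X * Xᵀ).trace := by
  have h := trace_self_mul_transpose_nonneg (X - Xᵀ)
  have e : (Xᵀ * Xᵀ).trace = (X * X).trace := by
    rw [← Matrix.transpose_mul, Matrix.trace_transpose]
  simp only [Matrix.transpose_sub, Matrix.transpose_transpose, sub_mul, mul_sub,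
    Matrix.trace_sub, e, Matrix.trace_mul_comm Xᵀ X] at h
  rw [pow_two]
  linarith

theorem trace_mul_le_of_isSymm {m : Type*} [Fintype m]
    {P Q : Matrix m m ℝ} (hP : P.IsSymm) (hQ : Q.IsSymm) :
    2 * (P * Q).trace ≤ (P * P).trace + (Q * Q).trace := by
  have h := trace_self_mul_transpose_nonneg (P - Q)
  simp only [Matrix.transpose_sub, hP.eq, hQ.eq, sub_mul, mul_sub, Matrix.trace_sub,
    Matrix.trace_mul_comm Q P] at h
  linarith

/-- The two families need each other. The first at `a + 1` is the first at `a` for `X ^ 2`, then the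
second at `a` for `X Xᵀ` and `Xᵀ X`, whose powers have equal traces. The second at `a + 1` is the
first at `a` for `P Q`, then the second at `a` for `P²` and `Q²`. -/
theorem trace_pow_two_pow_le_and {m : Type*} [Fintype m] [DecidableEq m]
    (a : ℕ) :
    (∀ X : Matrix m m ℝ, (X ^ 2 ^ (a + 1)).trace ≤ ((X * Xᵀ) ^ 2 ^ a).trace) ∧
    ∀ P Q : Matrix m m ℝ, P.IsSymm → Q.IsSymm →
      ((P * Q) ^ 2 ^ a).trace ≤ (P ^ 2 ^ a * Q ^ 2 ^ a).trace := by
  induction a with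
  | zero => exact ⟨fun X => by simpa using trace_sq_le X, fun P Q _ _ => by simp⟩
  | succ a ih =>
    obtain ⟨hf, hg⟩ := ih
    refine ⟨fun X => ?_, fun P Q hP hQ => ?_⟩
    · have hP : (X * Xᵀ).IsSymm := Matrix.isSymm_mul_transpose_self X
      have hQ : (Xᵀ * X).IsSymm := Matrix.isSymm_transpose_mul_self X
      have h1 : (X ^ 2 ^ (a + 1 + 1)).trace ≤ ((X * Xᵀ * (Xᵀ * X)) ^ 2 ^ a).trace := by
        have h := hf (X ^ 2)
        rw [← pow_mul, ← pow_succ'] at h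
        refine h.trans_eq ?_
        rw [Matrix.transpose_pow, pow_two, pow_two, mul_assoc X X, trace_mul_pow_comm]
        simp only [mul_assoc]
      have h2 := hg _ _ hP hQ
      have h3 := trace_mul_le_of_isSymm (hP.pow (2 ^ a)) (hQ.pow (2 ^ a))
      rw [← pow_add, ← pow_add, trace_mul_pow_comm Xᵀ X, ← two_mul (2 ^ a),
        ← two_mul (Matrix.trace _), ← pow_succ' 2 a] at h3
      linarith
    · have h1 := hf (P * Q)
      have h2 := hg (P * P) (Q * Q) (by simpa [pow_two] using hP.pow 2)
        (by simpa [pow_two] using hQ.pow 2)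
      have e : P * Q * (P * Q)ᵀ = P * Q ^ 2 * P := by
        rw [Matrix.transpose_mul, hP.eq, hQ.eq, pow_two]
        simp only [mul_assoc]
      rw [e, trace_mul_pow_comm (P * Q ^ 2) P, ← mul_assoc, ← pow_two] at h1
      rw [← pow_two, ← pow_two, ← pow_mul, ← pow_mul, ← pow_succ' 2 a] at h2
      exact h1.trans h2

open Filter Topology NormedSpace in
/-- The **Golden-Thompson inequality** for real symmetric matrices. -/
theorem trace_exp_add_le {m : Type*} [Fintype m] [DecidableEq m]
    {P Q : Matrix m m ℝ} (hP : P.IsSymm) (hQ : Q.IsSymm) :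
    (exp (P + Q)).trace ≤ (exp P * exp Q).trace := by
  cases isEmpty_or_nonempty m
  · simp [Matrix.trace]
  -- The exponential depends only on the topology, so any Banach algebra norm with `‖1‖ = 1` will
  -- do; the limit is taken along exponents `2 ^ a`.
  open scoped Matrix.Norms.L2Operator in
  have h := (tendsto_exp_mul_exp_pow P Q).comp
    (tendsto_pow_atTop_atTop_of_one_lt (r := 2) one_lt_two)
  have ht : Continuous fun M : Matrix m m ℝ => M.trace := continuous_id.matrix_trace
  refine le_of_tendsto ((ht.tendsto _).comp h) (Eventually.of_forall fun a => ?_)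
  have hs : ∀ X : Matrix m m ℝ, X.IsSymm → (exp (((2 ^ a : ℕ) : ℝ)⁻¹ • X)).IsSymm :=
    fun X hX => (hX.smul _).exp
  have hpow : ∀ X : Matrix m m ℝ, exp (((2 ^ a : ℕ) : ℝ)⁻¹ • X) ^ 2 ^ a = exp X := fun X => by
    rw [← Matrix.exp_nsmul, ← Nat.cast_smul_eq_nsmul ℝ, smul_smul, mul_inv_cancel₀ (by positivity),
      one_smul]
  have := (trace_pow_two_pow_le_and a).2 _ _ (hs P hP) (hs Q hQ)
  rwa [hpow, hpow] at this

end GoldenThompson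

/-! ### Functional calculus by diagonalization. -/

section Spectral

theorem isSymm_of_posSemidef {m : Type*} [Fintype m] {X : Matrix m m ℝ} (hX : X.PosSemidef) :
    X.IsSymm := by
  have h := hX.1.eq
  rwa [Matrix.conjTranspose_eq_transpose_of_trivial] at h

variable {m : Type*} [Fintype m] [DecidableEq m]

theorem spectral_decomp {X : Matrix m m ℝ} (hX : X.IsHermitian) :
    X = (hX.eigenvectorUnitary : Matrix m m ℝ) * Matrix.diagonal hX.eigenvalues *
      star (hX.eigenvectorUnitary : Matrix m m ℝ) := by
  have h := hX.spectral_theorem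
  rw [Unitary.conjStarAlgAut_apply] at h
  exact h

theorem star_eigenvectorUnitary_mul_self {X : Matrix m m ℝ} (hX : X.IsHermitian) :
    star (hX.eigenvectorUnitary : Matrix m m ℝ) * (hX.eigenvectorUnitary : Matrix m m ℝ) = 1 :=
  Unitary.coe_star_mul_self _

theorem eigenvectorUnitary_mul_star_self {X : Matrix m m ℝ} (hX : X.IsHermitian) :
    (hX.eigenvectorUnitary : Matrix m m ℝ) * star (hX.eigenvectorUnitary : Matrix m m ℝ) = 1 :=
  Unitary.coe_mul_star_self _

theorem star_eigenvectorUnitary_mul_mul {X : Matrix m m ℝ} (hX : X.IsHermitian) :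
    star (hX.eigenvectorUnitary : Matrix m m ℝ) * X * (hX.eigenvectorUnitary : Matrix m m ℝ)
      = Matrix.diagonal hX.eigenvalues := by
  have h := congrArg (fun Y => star (hX.eigenvectorUnitary : Matrix m m ℝ) * Y *
    (hX.eigenvectorUnitary : Matrix m m ℝ)) (spectral_decomp hX)
  refine h.trans ?_
  simp only [mul_assoc, star_eigenvectorUnitary_mul_self, mul_one]
  rw [← mul_assoc, star_eigenvectorUnitary_mul_self, one_mul]

theorem exp_smul_eq_conj_diagonal {X : Matrix m m ℝ} (hX : X.IsHermitian) (c : ℝ) :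
    NormedSpace.exp (c • X) = (hX.eigenvectorUnitary : Matrix m m ℝ) *
      Matrix.diagonal (fun i => Real.exp (c * hX.eigenvalues i)) *
      star (hX.eigenvectorUnitary : Matrix m m ℝ) := by
  have hu : (hX.eigenvectorUnitary : Matrix m m ℝ)⁻¹
      = star (hX.eigenvectorUnitary : Matrix m m ℝ) :=
    Matrix.inv_eq_left_inv (Unitary.coe_star_mul_self _)
  have hd : NormedSpace.exp (c • hX.eigenvalues)
      = fun i => Real.exp (c * hX.eigenvalues i) := by
    rw [Pi.exp_def]
    funext i
    simp [Real.exp_eq_exp_ℝ]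
  have hx : c • X = (hX.eigenvectorUnitary : Matrix m m ℝ) *
      Matrix.diagonal (c • hX.eigenvalues) * (hX.eigenvectorUnitary : Matrix m m ℝ)⁻¹ := by
    rw [hu, Matrix.diagonal_smul, Matrix.mul_smul, Matrix.smul_mul, ← spectral_decomp hX]
  have hunit : IsUnit (hX.eigenvectorUnitary : Matrix m m ℝ) :=
    ⟨Unitary.toUnits hX.eigenvectorUnitary, rfl⟩
  rw [hx, Matrix.exp_conj _ _ hunit, Matrix.exp_diagonal, hd, hu]

theorem trace_conj_diagonal {X : Matrix m m ℝ} (hX : X.IsHermitian) (e : m → ℝ) :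
    ((hX.eigenvectorUnitary : Matrix m m ℝ) * Matrix.diagonal e *
      star (hX.eigenvectorUnitary : Matrix m m ℝ)).trace = ∑ i, e i := by
  rw [Matrix.trace_mul_comm, ← mul_assoc, Unitary.coe_star_mul_self, one_mul,
    Matrix.trace_diagonal]

theorem posSemidef_conj_diagonal {X : Matrix m m ℝ} (hX : X.IsHermitian) {e : m → ℝ}
    (he : ∀ i, 0 ≤ e i) :
    ((hX.eigenvectorUnitary : Matrix m m ℝ) * Matrix.diagonal e *
      star (hX.eigenvectorUnitary : Matrix m m ℝ)).PosSemidef :=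
  (Matrix.PosSemidef.diagonal (d := e) he).mul_mul_conjTranspose_same _

theorem posSemidef_sub_smul_one {X : Matrix m m ℝ} (hX : X.IsHermitian) {c : ℝ}
    (hc : ∀ i, c ≤ hX.eigenvalues i) : (X - c • (1 : Matrix m m ℝ)).PosSemidef := by
  have h := posSemidef_conj_diagonal hX (e := fun i => hX.eigenvalues i - c)
    (fun i => sub_nonneg.2 (hc i))
  rw [← Matrix.diagonal_sub, mul_sub, sub_mul, ← spectral_decomp hX, ← Matrix.smul_one_eq_diagonal,
    Matrix.mul_smul, mul_one, Matrix.smul_mul, eigenvectorUnitary_mul_star_self] at h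
  exact h

/-- Each `exp (-θ λ_i)` is at most the trace, so a small trace forces every eigenvalue above `c`. -/
theorem posSemidef_sub_of_trace_exp_lt {T : Matrix m m ℝ} (hT : T.IsHermitian) {c θ : ℝ}
    (hθ : 0 < θ) (h : (NormedSpace.exp (-(θ • T))).trace < Real.exp (-(θ * c))) :
    (T - c • (1 : Matrix m m ℝ)).PosSemidef := by
  refine posSemidef_sub_smul_one hT fun i => ?_
  rw [← neg_smul, exp_smul_eq_conj_diagonal hT, trace_conj_diagonal] at h
  have h1 := Finset.single_le_sum (f := fun i => Real.exp (-θ * hT.eigenvalues i))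
    (fun j _ => (Real.exp_pos _).le) (Finset.mem_univ i)
  have h2 := Real.exp_lt_exp.1 (h1.trans_lt h)
  nlinarith

/-- Follows from `exp (-x) ≤ 1 / (1 + x) ≤ 1 - x + x²` and `x² ≤ s x`. -/
theorem exp_neg_le_one_sub {x s : ℝ} (h0 : 0 ≤ x) (hs : x ≤ s) :
    Real.exp (-x) ≤ 1 - (1 - s) * x := by
  have h1 : Real.exp (-x) * (1 + x) ≤ 1 := by
    have := mul_le_mul_of_nonneg_left (Real.add_one_le_exp x) (Real.exp_pos (-x)).le
    rw [← Real.exp_add, neg_add_cancel, Real.exp_zero] at this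
    linarith
  have h2 : Real.exp (-x) ≤ 1 - x + x ^ 2 := by
    have h3 : (1 - x + x ^ 2) * (1 + x) = 1 + x ^ 3 := by ring
    have h4 : 0 ≤ x ^ 3 := by positivity
    exact le_of_mul_le_mul_right (by linarith) (by linarith : 0 < 1 + x)
  nlinarith

theorem posSemidef_one_sub_sub_exp_neg {X : Matrix m m ℝ} {s : ℝ} (hX : X.PosSemidef)
    (hs : (s • (1 : Matrix m m ℝ) - X).PosSemidef) :
    (1 - (1 - s) • X - NormedSpace.exp (-X)).PosSemidef := by
  have hH := hX.isHermitian
  have hle : ∀ i, hH.eigenvalues i ≤ s := fun i => by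
    have h := hs.conjTranspose_mul_mul_same (hH.eigenvectorUnitary : Matrix m m ℝ)
    have e : (hH.eigenvectorUnitary : Matrix m m ℝ)ᴴ * (s • (1 : Matrix m m ℝ) - X) *
        (hH.eigenvectorUnitary : Matrix m m ℝ) = Matrix.diagonal fun i => s - hH.eigenvalues i := by
      rw [← Matrix.star_eq_conjTranspose, mul_sub, sub_mul, ← Matrix.diagonal_sub,
        ← Matrix.smul_one_eq_diagonal, Matrix.mul_smul, mul_one, Matrix.smul_mul,
        star_eigenvectorUnitary_mul_self, star_eigenvectorUnitary_mul_mul]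
    rw [e, Matrix.posSemidef_diagonal_iff] at h
    linarith [h i]
  have h := posSemidef_conj_diagonal hH
    (e := fun i => 1 - (1 - s) * hH.eigenvalues i - Real.exp (-1 * hH.eigenvalues i)) fun i => by
      have := exp_neg_le_one_sub (hX.eigenvalues_nonneg i) (hle i)
      rw [neg_one_mul]
      linarith
  rw [← Matrix.diagonal_sub, ← Matrix.diagonal_sub, mul_sub, sub_mul, mul_sub, sub_mul,
    ← exp_smul_eq_conj_diagonal hH, neg_one_smul, Matrix.diagonal_one, mul_one,
    eigenvectorUnitary_mul_star_self] at h
  convert h using 3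
  conv_lhs => rw [spectral_decomp hH]
  rw [← Matrix.smul_mul, ← Matrix.mul_smul, ← Matrix.diagonal_smul]
  rfl

/-- Writing `exp A` as the square of the symmetric `exp (A / 2)` turns this into the trace of a
congruence of `P`. -/
theorem trace_exp_mul_nonneg {A P : Matrix m m ℝ} (hA : A.IsSymm) (hP : P.PosSemidef) :
    0 ≤ (NormedSpace.exp A * P).trace := by
  have e : NormedSpace.exp A = NormedSpace.exp ((1 / 2 : ℝ) • A) * NormedSpace.exp ((1 / 2 : ℝ) • A) := by
    rw [← Matrix.exp_add_of_commute _ _ (Commute.refl _), ← add_smul]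
    norm_num
  have hs : (NormedSpace.exp ((1 / 2 : ℝ) • A))ᴴ = NormedSpace.exp ((1 / 2 : ℝ) • A) := by
    rw [Matrix.conjTranspose_eq_transpose_of_trivial]
    exact (hA.smul _).exp
  have h := (hP.conjTranspose_mul_mul_same (NormedSpace.exp ((1 / 2 : ℝ) • A))).trace_nonneg
  rwa [hs, Matrix.trace_mul_comm, ← mul_assoc, ← e] at h

theorem continuous_matrix_exp : Continuous fun M : Matrix m m ℝ => NormedSpace.exp M := by
  open scoped Matrix.Norms.L2Operator in
  let _ : NormedAlgebra ℚ (Matrix m m ℝ) := NormedAlgebra.restrictScalars ℚ ℝ _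
  exact NormedSpace.exp_continuous

end Spectral

/-! ### Matrix Laplace transform and Chernoff bound. -/

section Laplace

variable {m : Type*} [Fintype m] [DecidableEq m] {Ω : Type*} [MeasurableSpace Ω]

/-- Golden-Thompson separates `A` from `X`, and the linear upper bound for `exp (-X)` makes the
integrand affine in `X`, so only the mean of `X` matters. The final step is `1 - y ≤ exp (-y)`. -/
theorem lintegral_trace_exp_sub_le {μ : Measure Ω} [IsProbabilityMeasure μ]
    {X : Ω → Matrix m m ℝ} {s lo : ℝ} (hs1 : s ≤ 1) (hpos : ∀ w, (X w).PosSemidef)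
    (hs : ∀ w, (s • (1 : Matrix m m ℝ) - X w).PosSemidef)
    (hint : ∀ i j, Integrable (fun w => X w i j) μ)
    (hmean : ((Matrix.of fun i j => ∫ w, X w i j ∂μ) - lo • (1 : Matrix m m ℝ)).PosSemidef)
    {A : Matrix m m ℝ} (hA : A.IsSymm) :
    ∫⁻ w, ENNReal.ofReal (NormedSpace.exp (A - X w)).trace ∂μ
      ≤ ENNReal.ofReal (Real.exp (-((1 - s) * lo))) * ENNReal.ofReal (NormedSpace.exp A).trace := by
  set E := NormedSpace.exp A with hE
  set M : Matrix m m ℝ := Matrix.of fun i j => ∫ w, X w i j ∂μ with hM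
  have hlin : ∀ Y : Matrix m m ℝ, (E * (1 - (1 - s) • Y)).trace
      = E.trace - (1 - s) * ∑ i, ∑ j, E i j * Y j i := fun Y => by
    rw [mul_sub, mul_one, Matrix.trace_sub, Matrix.mul_smul, Matrix.trace_smul, smul_eq_mul]
    rfl
  have hptw : ∀ w, (NormedSpace.exp (A - X w)).trace ≤ (E * (1 - (1 - s) • X w)).trace := fun w => by
    have h1 := trace_exp_add_le hA (isSymm_of_posSemidef (hpos w)).neg
    have h2 := trace_exp_mul_nonneg hA (posSemidef_one_sub_sub_exp_neg (hpos w) (hs w))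
    rw [mul_sub, Matrix.trace_sub] at h2
    rw [sub_eq_add_neg]
    linarith
  have hE0 : 0 ≤ E.trace := by simpa using trace_exp_mul_nonneg hA Matrix.PosSemidef.one
  have hnn : ∀ B : Matrix m m ℝ, B.IsSymm → 0 ≤ (NormedSpace.exp B).trace := fun B hB => by
    simpa using trace_exp_mul_nonneg hB Matrix.PosSemidef.one
  have hsi : ∀ i, Integrable (fun w => ∑ j, E i j * X w j i) μ := fun i =>
    integrable_finsetSum _ fun j _ => (hint j i).const_mul (E i j)
  have hsum : Integrable (fun w => ∑ i, ∑ j, E i j * X w j i) μ :=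
    integrable_finsetSum _ fun i _ => hsi i
  have hfi : Integrable (fun w => (E * (1 - (1 - s) • X w)).trace) μ := by
    simp_rw [hlin]
    exact (integrable_const _).sub (hsum.const_mul _)
  have hfint : ∫ w, (E * (1 - (1 - s) • X w)).trace ∂μ = (E * (1 - (1 - s) • M)).trace := by
    have h1 : ∫ w, ∑ i, ∑ j, E i j * X w j i ∂μ = ∑ i, ∑ j, E i j * M j i := by
      rw [integral_finsetSum _ fun i _ => hsi i]
      refine Finset.sum_congr rfl fun i _ => ?_
      rw [integral_finsetSum _ fun j _ => (hint j i).const_mul (E i j)]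
      exact Finset.sum_congr rfl fun j _ => integral_const_mul _ _
    rw [hlin, ← h1]
    simp_rw [hlin]
    rw [integral_sub (integrable_const _) (hsum.const_mul _), integral_const_mul, integral_const,
      probReal_univ, one_smul]
  have hbound : (E * (1 - (1 - s) • M)).trace ≤ Real.exp (-((1 - s) * lo)) * E.trace := by
    have h := trace_exp_mul_nonneg hA hmean
    rw [mul_sub, Matrix.trace_sub, Matrix.mul_smul, Matrix.trace_smul, mul_one, smul_eq_mul] at h
    rw [mul_sub, Matrix.trace_sub, Matrix.mul_smul, Matrix.trace_smul, mul_one, smul_eq_mul]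
    have h2 := mul_le_mul_of_nonneg_right (Real.add_one_le_exp (-((1 - s) * lo))) hE0
    have h3 := mul_nonneg (sub_nonneg.2 hs1) h
    linarith
  calc ∫⁻ w, ENNReal.ofReal (NormedSpace.exp (A - X w)).trace ∂μ
      ≤ ∫⁻ w, ENNReal.ofReal (E * (1 - (1 - s) • X w)).trace ∂μ :=
        lintegral_mono fun w => ENNReal.ofReal_le_ofReal (hptw w)
    _ = ENNReal.ofReal (∫ w, (E * (1 - (1 - s) • X w)).trace ∂μ) := by
        rw [ofReal_integral_eq_lintegral_ofReal hfi]
        refine Filter.Eventually.of_forall fun w => le_trans ?_ (hptw w)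
        exact hnn _ (hA.sub (isSymm_of_posSemidef (hpos w)))
    _ ≤ ENNReal.ofReal (Real.exp (-((1 - s) * lo)) * E.trace) := by
        rw [hfint]
        exact ENNReal.ofReal_le_ofReal hbound
    _ = _ := ENNReal.ofReal_mul (Real.exp_pos _).le

/-- Induction with `A` arbitrary: by Tonelli the first summand is frozen and absorbed into `A` while
the others are integrated out, then is integrated itself. -/
theorem lintegral_trace_exp_sub_sum_le [TopologicalSpace Ω] [BorelSpace Ω]
    [SecondCountableTopology Ω] {μ : Measure Ω} [IsProbabilityMeasure μ] {k : ℕ}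
    {X : Fin k → Ω → Matrix m m ℝ} {q : Fin k → ENNReal} (hcont : ∀ j, Continuous (X j))
    (hsymm : ∀ j w, (X j w).IsSymm)
    (hstep : ∀ j (A : Matrix m m ℝ), A.IsSymm →
      ∫⁻ w, ENNReal.ofReal (NormedSpace.exp (A - X j w)).trace ∂μ
        ≤ q j * ENNReal.ofReal (NormedSpace.exp A).trace)
    {A : Matrix m m ℝ} (hA : A.IsSymm) :
    ∫⁻ W : Fin k → Ω, ENNReal.ofReal (NormedSpace.exp (A - ∑ j, X j (W j))).trace
      ∂(Measure.pi fun _ => μ) ≤ (∏ j, q j) * ENNReal.ofReal (NormedSpace.exp A).trace := by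
  induction k generalizing A with
  | zero => simp
  | succ k ih =>
    have hmp := (measurePreserving_piFinSuccAbove (fun _ : Fin (k + 1) => μ) 0).symm
    rw [← hmp.lintegral_comp_emb (MeasurableEquiv.measurableEmbedding _)]
    have hcongr : ∀ p : Ω × (Fin k → Ω),
        A - ∑ j, X j ((MeasurableEquiv.piFinSuccAbove (fun _ : Fin (k + 1) => Ω) 0).symm p j)
          = A - X 0 p.1 - ∑ j : Fin k, X j.succ (p.2 j) := fun p => by
      rw [Fin.sum_univ_succ, sub_sub]
      simp [MeasurableEquiv.piFinSuccAbove_symm_apply, Fin.insertNthEquiv]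
    simp_rw [hcongr]
    have hmeas : Measurable fun p : Ω × (Fin k → Ω) =>
        ENNReal.ofReal (NormedSpace.exp (A - X 0 p.1 - ∑ j : Fin k, X j.succ (p.2 j))).trace := by
      refine (Continuous.measurable ?_).ennreal_ofReal
      refine (continuous_matrix_exp.comp ?_).matrix_trace
      refine (continuous_const.sub ((hcont 0).comp continuous_fst)).sub ?_
      exact continuous_finsetSum _ fun j _ =>
        (hcont _).comp ((continuous_apply j).comp continuous_snd)
    rw [lintegral_prod _ hmeas.aemeasurable]
    calc _ ≤ ∫⁻ w, (∏ j : Fin k, q j.succ) * ENNReal.ofReal (NormedSpace.exp (A - X 0 w)).trace ∂μ :=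
          lintegral_mono fun w => ih (fun j => hcont j.succ) (fun j => hsymm j.succ)
            (fun j => hstep j.succ) (hA.sub (hsymm 0 w))
      _ ≤ (∏ j : Fin k, q j.succ) * (q 0 * ENNReal.ofReal (NormedSpace.exp A).trace) := by
          rw [lintegral_const_mul]
          · gcongr
            exact hstep 0 A hA
          · refine (Continuous.measurable ?_).ennreal_ofReal
            exact (continuous_matrix_exp.comp (continuous_const.sub (hcont 0))).matrix_trace
      _ = _ := by
          rw [Fin.prod_univ_succ, ← mul_assoc, mul_comm (q 0)]

/-- A **matrix Chernoff bound** for the smallest eigenvalue of a sum of independent copies of a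
bounded positive semidefinite random matrix, of which those selected by `a` are kept. -/
theorem matrix_chernoff_lower [TopologicalSpace Ω] [BorelSpace Ω]
    [SecondCountableTopology Ω] {μ : Measure Ω} [IsProbabilityMeasure μ] {k : ℕ}
    {H : Ω → Matrix m m ℝ} {B lo s t : ℝ} (hB : 0 < B) (hs0 : 0 < s) (hs1 : s ≤ 1)
    (hcont : Continuous H) (hpos : ∀ w, (H w).PosSemidef)
    (hle : ∀ w, (B • (1 : Matrix m m ℝ) - H w).PosSemidef)
    (hint : ∀ i j, Integrable (fun w => H w i j) μ)
    (hmean : ((Matrix.of fun i j => ∫ w, H w i j ∂μ) - lo • (1 : Matrix m m ℝ)).PosSemidef)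
    {a : Fin k → ℝ} (ha : ∀ j, a j = 0 ∨ a j = 1) :
    1 - Fintype.card m * Real.exp (s / B * (t - (∑ j, a j) * ((1 - s) * lo))) ≤
      (Measure.pi fun _ : Fin k => μ).real
        {W | (∑ j, a j • H (W j) - t • (1 : Matrix m m ℝ)).PosSemidef} := by
  -- The choice that gives `θ H ⪯ s`, the range in which the linear bound on the exponential holds.
  set θ := s / B with hθ
  have hθ0 : 0 < θ := by positivity
  have hθB : θ * B = s := by rw [hθ]; field_simp
  set P := Measure.pi fun _ : Fin k => μ
  have hHs : ∀ w, (H w).IsSymm := fun w => isSymm_of_posSemidef (hpos w)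
  have hstep : ∀ j (A : Matrix m m ℝ), A.IsSymm →
      ∫⁻ w, ENNReal.ofReal (NormedSpace.exp (A - (θ * a j) • H w)).trace ∂μ
        ≤ ENNReal.ofReal (Real.exp (-(a j * ((1 - s) * (θ * lo))))) *
          ENNReal.ofReal (NormedSpace.exp A).trace := fun j A hA => by
    rcases ha j with h | h
    · simp [h]
    · rw [h, mul_one, one_mul]
      refine lintegral_trace_exp_sub_le hs1 (fun w => (hpos w).smul hθ0.le) (fun w => ?_)
        (fun i j => (hint i j).const_mul θ) ?_ hA
      · have := (hle w).smul hθ0.le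
        rwa [smul_sub, smul_smul, hθB] at this
      · have := hmean.smul hθ0.le
        rw [smul_sub, smul_smul] at this
        convert this using 2
        ext i j
        simp [integral_const_mul]
  have hlap := lintegral_trace_exp_sub_sum_le (μ := μ) (X := fun j w => (θ * a j) • H w)
    (fun j => hcont.const_smul (θ * a j)) (fun j w => (hHs w).smul _) hstep (A := 0) (by simp [Matrix.IsSymm])
  rw [← ENNReal.ofReal_prod_of_nonneg fun _ _ => (Real.exp_pos _).le, ← Real.exp_sum,
    NormedSpace.exp_zero, Matrix.trace_one, ← ENNReal.ofReal_mul (Real.exp_pos _).le] at hlap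
  set T : (Fin k → Ω) → Matrix m m ℝ := fun W => ∑ j, a j • H (W j) with hT
  have hTc : Continuous T := continuous_finsetSum _ fun j _ =>
    Continuous.const_smul (hcont.comp (continuous_apply j)) (a j)
  have hTe : ∀ W : Fin k → Ω, 0 - ∑ j, (θ * a j) • H (W j) = -(θ • T W) := fun W => by
    rw [zero_sub, hT, Finset.smul_sum]
    simp_rw [smul_smul]
  simp_rw [hTe] at hlap
  have hfm : Measurable fun W => (NormedSpace.exp (-(θ • T W))).trace :=
    (continuous_matrix_exp.comp (hTc.const_smul θ).neg).matrix_trace.measurable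
  -- Markov is applied to the trace, which is continuous and hence measurable; the target event need
  -- only contain the complement of `bad`.
  set bad : Set (Fin k → Ω) :=
    {W | Real.exp (-(θ * t)) ≤ (NormedSpace.exp (-(θ • T W))).trace} with hbad
  have hbm : MeasurableSet bad := measurableSet_le measurable_const hfm
  have hsub : badᶜ ⊆ {W | (T W - t • (1 : Matrix m m ℝ)).PosSemidef} := fun W hW => by
    refine posSemidef_sub_of_trace_exp_lt ?_ hθ0 (not_le.1 hW)
    exact (Matrix.posSemidef_sum _ fun j _ => (hpos (W j)).smul
      (by rcases ha j with h | h <;> simp [h])).1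
  have hmarkov : P.real bad ≤ Fintype.card m * Real.exp (θ * (t - (∑ j, a j) * ((1 - s) * lo))) := by
    have h1 := meas_ge_le_lintegral_div (μ := P)
      (f := fun W => ENNReal.ofReal (NormedSpace.exp (-(θ • T W))).trace)
      hfm.ennreal_ofReal.aemeasurable (ε := ENNReal.ofReal (Real.exp (-(θ * t))))
      (by simp [Real.exp_pos]) ENNReal.ofReal_ne_top
    have h2 : P bad ≤ ENNReal.ofReal
        (Fintype.card m * Real.exp (θ * (t - (∑ j, a j) * ((1 - s) * lo)))) := by
      refine (measure_mono fun W hW => ?_).trans (h1.trans ((ENNReal.div_le_div_right hlap _).trans ?_))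
      · exact ENNReal.ofReal_le_ofReal hW
      · rw [← ENNReal.ofReal_div_of_pos (Real.exp_pos _)]
        refine ENNReal.ofReal_le_ofReal (le_of_eq ?_)
        rw [Finset.sum_neg_distrib, ← Finset.sum_mul, mul_comm, mul_div_assoc, ← Real.exp_sub]
        congr 2
        ring
    exact ENNReal.toReal_le_of_le_ofReal (by positivity) h2
  calc _ ≤ 1 - P.real bad := by linarith
    _ = P.real badᶜ := (probReal_compl_eq_one_sub hbm).symm
    _ ≤ _ := measureReal_mono hsub

end Laplace

/-! ### Spectral norm in coordinates. -/

section SpectralNorm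

variable {m p : Type*} [Fintype m] [Fintype p] [DecidableEq p]

theorem specNorm_nonneg (M : Matrix m p ℝ) : 0 ≤ specNorm M := norm_nonneg _

theorem specNorm_transpose [DecidableEq m] (M : Matrix m p ℝ) : specNorm Mᵀ = specNorm M := by
  open scoped Matrix.Norms.L2Operator in
  have h := Matrix.l2_opNorm_conjTranspose M
  rw [Matrix.conjTranspose_eq_transpose_of_trivial] at h
  exact h

theorem sum_mulVec_sq_le (M : Matrix m p ℝ) (x : p → ℝ) :
    ∑ i, (M *ᵥ x) i ^ 2 ≤ specNorm M ^ 2 * ∑ j, x j ^ 2 := by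
  have h := (LinearMap.toContinuousLinearMap (Matrix.toEuclideanLin M)).le_opNorm (WithLp.toLp 2 x)
  have h2 := pow_le_pow_left₀ (norm_nonneg _) h 2
  rw [mul_pow, EuclideanSpace.real_norm_sq_eq, EuclideanSpace.real_norm_sq_eq] at h2
  exact h2

theorem specNorm_le_of_sum_sq_le {M : Matrix m p ℝ} {c : ℝ} (hc : 0 ≤ c)
    (h : ∀ x : p → ℝ, ∑ i, (M *ᵥ x) i ^ 2 ≤ c ^ 2 * ∑ j, x j ^ 2) : specNorm M ≤ c := by
  refine ContinuousLinearMap.opNorm_le_bound _ hc fun x => ?_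
  refine le_of_sq_le_sq ?_ (by positivity)
  rw [mul_pow, EuclideanSpace.real_norm_sq_eq, EuclideanSpace.real_norm_sq_eq]
  exact h x.ofLp

end SpectralNorm

/-! ### Consequences of the form of the output weights. -/

namespace IsOutputWeights

variable {k : ℕ} {v : Fin k → ℝ}

/-- The three level sets are disjoint and their sizes add up to `2 (k / 2) + k % 2 = k`. -/
theorem eq_or_eq_or_eq (hv : IsOutputWeights v) (j : Fin k) :
    v j = 1 / √(k : ℝ) ∨ v j = -(1 / √(k : ℝ)) ∨ v j = 0 := by
  obtain ⟨h1, h2, h3⟩ := hv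
  have hk : 0 < k := j.pos
  have hpos : 0 < 1 / √(k : ℝ) := by positivity
  have hd1 : Disjoint (Finset.univ.filter fun j => v j = 1 / √(k : ℝ))
      (Finset.univ.filter fun j => v j = -(1 / √(k : ℝ))) :=
    Finset.disjoint_filter.2 fun i _ hi hi' => by linarith
  have hd2 : Disjoint ((Finset.univ.filter fun j => v j = 1 / √(k : ℝ)) ∪
      (Finset.univ.filter fun j => v j = -(1 / √(k : ℝ))))
      (Finset.univ.filter fun j => v j = 0) :=
    Finset.disjoint_union_left.2 ⟨Finset.disjoint_filter.2 fun i _ hi hi' => by linarith,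
      Finset.disjoint_filter.2 fun i _ hi hi' => by linarith⟩
  have hu := Finset.eq_univ_of_card _ (by
    rw [Finset.card_union_of_disjoint hd2, Finset.card_union_of_disjoint hd1, h1, h2, h3,
      Fintype.card_fin]
    omega)
  have hj := hu.symm ▸ Finset.mem_univ j
  simpa [or_assoc] using hj

theorem mul_sq_eq (hv : IsOutputWeights v) (j : Fin k) :
    (k : ℝ) * v j ^ 2 = if v j = 0 then 0 else 1 := by
  have hk : (0 : ℝ) < k := by exact_mod_cast j.pos
  have hpos : 0 < 1 / √(k : ℝ) := by positivity
  have hs : (k : ℝ) * (1 / √(k : ℝ)) ^ 2 = 1 := by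
    rw [div_pow, Real.sq_sqrt hk.le]; field_simp
  rcases hv.eq_or_eq_or_eq j with h | h | h
  · rw [if_neg (by linarith), h, hs]
  · rw [if_neg (by linarith), h, neg_sq, hs]
  · simp [h]

theorem sum_mul_sq (hv : IsOutputWeights v) : ∑ j, (k : ℝ) * v j ^ 2 = k - (k % 2 : ℕ) := by
  simp_rw [hv.mul_sq_eq]
  have h := Finset.card_filter_add_card_filter_not (s := Finset.univ) (fun j => v j = 0)
  rw [hv.2.2, Finset.card_univ, Fintype.card_fin] at h
  have e : ∑ j, (if v j = 0 then (0 : ℝ) else 1)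
      = ((Finset.univ.filter fun j => ¬ v j = 0).card : ℝ) := by
    rw [Finset.card_eq_sum_ones, Finset.sum_filter]
    push_cast
    exact Finset.sum_congr rfl fun j _ => by split_ifs <;> simp_all
  rw [e, eq_sub_iff_add_eq, add_comm]
  exact_mod_cast h

theorem sq_le (hv : IsOutputWeights v) (j : Fin k) : v j ^ 2 ≤ 1 / k := by
  have hk : (0 : ℝ) < k := by exact_mod_cast j.pos
  rw [le_div_iff₀ hk, mul_comm, hv.mul_sq_eq]
  split_ifs <;> norm_num

theorem sum_sq_le_one (hv : IsOutputWeights v) : ∑ j, v j ^ 2 ≤ 1 := by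
  refine (Finset.sum_le_sum fun j _ => hv.sq_le j).trans ?_
  rw [Finset.sum_const, Finset.card_univ, Fintype.card_fin, nsmul_eq_mul]
  rw [mul_one_div]
  exact div_self_le_one _

end IsOutputWeights

/-! ### The Jacobian at clean inputs, reduced to clusters. -/

section Jacobian

variable {n d K Kbar : ℕ} {ε₀ δ cLow cUp : ℝ}
  (D : ClusterableDataset n d K Kbar ε₀ δ cLow cUp)

theorem jacobian_cleanMatrix_apply {k : ℕ} (φ : ℝ → ℝ) (v : Fin k → ℝ)
    (W : Matrix (Fin k) (Fin d) ℝ) (i : Fin n) (jl : Fin k × Fin d) :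
    jacobian φ v W D.cleanMatrix i jl =
      v jl.1 * deriv φ ((D.centerMatrix *ᵥ W jl.1) (D.cluster i)) *
        D.centerMatrix (D.cluster i) jl.2 := by
  simp only [jacobian, khatriRao, Matrix.transpose_apply, Matrix.of_apply, Matrix.diagonal_mul,
    Matrix.map_apply]
  congr 3
  simp only [Matrix.mul_apply, Matrix.mulVec, dotProduct, Matrix.transpose_apply]
  exact Finset.sum_congr rfl fun l _ => mul_comm _ _

theorem sum_comp_cluster_le (f : Fin K → ℝ) (hf : ∀ l, 0 ≤ f l) :
    ∑ i, f (D.cluster i) ≤ cUp * n / K * ∑ l, f l := by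
  rw [← Finset.sum_fiberwise (s := Finset.univ) (g := D.cluster), Finset.mul_sum]
  refine Finset.sum_le_sum fun l _ => ?_
  rw [Finset.sum_congr rfl (g := fun _ => f l) fun i hi => by rw [(Finset.mem_filter.1 hi).2],
    Finset.sum_const, nsmul_eq_mul, mul_div_assoc]
  exact mul_le_mul_of_nonneg_right (D.card_upper l) (hf l)

/-- Common source of both norm bounds: `M x` takes one value `y l` per cluster, Cauchy-Schwarz over
neurons extracts `∑ β_j²`, and each neuron's block of `x` costs one factor `‖C‖²`. -/
theorem specNorm_le_of_entries {k : ℕ} {M : Matrix (Fin n) (Fin k × Fin d) ℝ}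
    {a : Fin k → Fin K → ℝ} {β : Fin k → ℝ}
    (hM : ∀ i jl, M i jl = a jl.1 (D.cluster i) * D.centerMatrix (D.cluster i) jl.2)
    (ha : ∀ j l, |a j l| ≤ β j) :
    specNorm M ≤ √(cUp * n / K) * √(∑ j, β j ^ 2) * specNorm D.centerMatrix := by
  have hcUp : 0 ≤ cUp := (D.cLow_pos.trans D.cLow_lt_cUp).le
  refine specNorm_le_of_sum_sq_le
    (mul_nonneg (by positivity) (specNorm_nonneg _)) fun x => ?_
  rw [mul_pow, mul_pow, Real.sq_sqrt (by positivity),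
    Real.sq_sqrt (Finset.sum_nonneg fun _ _ => sq_nonneg _)]
  set y : Fin K → ℝ := fun l => ∑ j, a j l * (D.centerMatrix *ᵥ fun q => x (j, q)) l with hy
  have hMy : ∀ i, (M *ᵥ x) i = y (D.cluster i) := fun i => by
    simp only [Matrix.mulVec, dotProduct, Fintype.sum_prod_type, hM, hy, Finset.mul_sum, mul_assoc]
  simp_rw [hMy]
  refine (sum_comp_cluster_le D (fun l => y l ^ 2) fun l => sq_nonneg _).trans ?_
  rw [mul_assoc, mul_assoc]
  refine mul_le_mul_of_nonneg_left ?_ (by positivity)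
  have hyl : ∀ l, y l ^ 2 ≤ (∑ j, β j ^ 2) *
      ∑ j, (D.centerMatrix *ᵥ fun q => x (j, q)) l ^ 2 := fun l => by
    refine (Finset.sum_mul_sq_le_sq_mul_sq _ _ _).trans ?_
    refine mul_le_mul_of_nonneg_right ?_ (Finset.sum_nonneg fun _ _ => sq_nonneg _)
    exact Finset.sum_le_sum fun j _ => sq_le_sq' (abs_le.1 (ha j l)).1 (abs_le.1 (ha j l)).2
  refine (Finset.sum_le_sum fun l _ => hyl l).trans ?_
  rw [← Finset.mul_sum]
  refine mul_le_mul_of_nonneg_left ?_ (Finset.sum_nonneg fun _ _ => sq_nonneg _)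
  rw [Finset.sum_comm, Fintype.sum_prod_type, Finset.mul_sum]
  exact Finset.sum_le_sum fun j _ => sum_mulVec_sq_le _ _

theorem specNorm_jacobian_le {k : ℕ} {φ : ℝ → ℝ} {v : Fin k → ℝ} {Γ : ℝ} (hv : IsOutputWeights v)
    (hφ : ∀ z, |deriv φ z| ≤ Γ) (W : Matrix (Fin k) (Fin d) ℝ) :
    specNorm (jacobian φ v W D.cleanMatrix) ≤ √(cUp * n / K) * Γ * specNorm D.centerMatrix := by
  have hΓ : 0 ≤ Γ := (abs_nonneg _).trans (hφ 0)
  refine (specNorm_le_of_entries D (β := fun j => |v j| * Γ)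
    (a := fun j l => v j * deriv φ ((D.centerMatrix *ᵥ W j) l)) (jacobian_cleanMatrix_apply D φ v W) fun j l => ?_).trans ?_
  · rw [abs_mul]
    exact mul_le_mul_of_nonneg_left (hφ _) (abs_nonneg _)
  · refine mul_le_mul_of_nonneg_right ?_ (specNorm_nonneg _)
    refine mul_le_mul_of_nonneg_left ?_ (Real.sqrt_nonneg _)
    refine Real.sqrt_le_iff.2 ⟨hΓ, ?_⟩
    simp_rw [mul_pow, sq_abs]
    rw [← Finset.sum_mul]
    exact mul_le_of_le_one_left (sq_nonneg _) hv.sum_sq_le_one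

theorem sum_centerMatrix_sq (l : Fin K) : ∑ q, D.centerMatrix l q ^ 2 = 1 := by
  have h := EuclideanSpace.real_norm_sq_eq (D.center l)
  rw [D.norm_center, one_pow] at h
  exact h.symm

theorem specNorm_jacobian_sub_le {k : ℕ} {φ : ℝ → ℝ} {v : Fin k → ℝ} {Γ : ℝ}
    (hv : IsOutputWeights v) (hd : Differentiable ℝ (deriv φ))
    (hφ : ∀ z, |deriv (deriv φ) z| ≤ Γ) (W' W : Matrix (Fin k) (Fin d) ℝ) :
    specNorm (jacobian φ v W' D.cleanMatrix - jacobian φ v W D.cleanMatrix) ≤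
      Γ * √(cUp * n / (k * K)) * specNorm D.centerMatrix * frobNorm (W' - W) := by
  have hΓ : 0 ≤ Γ := (abs_nonneg _).trans (hφ 0)
  have hcUp : 0 ≤ cUp := (D.cLow_pos.trans D.cLow_lt_cUp).le
  have hlip : ∀ y z, |deriv φ y - deriv φ z| ≤ Γ * |y - z| := fun y z =>
    Convex.norm_image_sub_le_of_norm_deriv_le (𝕜 := ℝ) (s := Set.univ) (fun x _ => hd x)
      (fun x _ => hφ x) convex_univ (Set.mem_univ z) (Set.mem_univ y)
  refine (specNorm_le_of_entries D
    (a := fun j l => v j * (deriv φ ((D.centerMatrix *ᵥ W' j) l)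
      - deriv φ ((D.centerMatrix *ᵥ W j) l)))
    (β := fun j => |v j| * (Γ * √(∑ q, (W' - W) j q ^ 2))) (fun i jl => ?_) fun j l => ?_).trans ?_
  · rw [Matrix.sub_apply, jacobian_cleanMatrix_apply, jacobian_cleanMatrix_apply]
    ring
  · rw [abs_mul]
    refine mul_le_mul_of_nonneg_left ((hlip _ _).trans ?_) (abs_nonneg _)
    refine mul_le_mul_of_nonneg_left ?_ hΓ
    -- Cauchy-Schwarz against the unit vector `c_l`.
    refine Real.abs_le_sqrt ?_
    have h := Finset.sum_mul_sq_le_sq_mul_sq Finset.univ (D.centerMatrix l) ((W' - W) j)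
    rw [sum_centerMatrix_sq, one_mul] at h
    refine le_of_eq_of_le ?_ h
    congr 1
    simp only [Matrix.mulVec, dotProduct, Matrix.sub_apply, mul_sub, Finset.sum_sub_distrib]
  · have h1 : √(∑ j, (|v j| * (Γ * √(∑ q, (W' - W) j q ^ 2))) ^ 2)
        ≤ √(1 / k) * (Γ * frobNorm (W' - W)) := by
      refine Real.sqrt_le_iff.2 ⟨by unfold frobNorm; positivity, ?_⟩
      simp only [mul_pow, sq_abs, frobNorm]
      rw [Real.sq_sqrt (by positivity), Real.sq_sqrt (by positivity), Finset.mul_sum,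
        Finset.mul_sum]
      refine Finset.sum_le_sum fun j _ => ?_
      rw [Real.sq_sqrt (by positivity)]
      exact mul_le_mul_of_nonneg_right (hv.sq_le j) (by positivity)
    have h2 : √(cUp * n / (k * K)) = √(cUp * n / K) * √(1 / k) := by
      rw [← Real.sqrt_mul (by positivity)]
      congr 1
      rw [div_mul_div_comm, mul_one, mul_comm (k : ℝ)]
    rw [h2]
    calc _ ≤ √(cUp * n / K) * (√(1 / k) * (Γ * frobNorm (W' - W))) * specNorm D.centerMatrix :=
          mul_le_mul_of_nonneg_right (mul_le_mul_of_nonneg_left h1 (Real.sqrt_nonneg _))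
            (specNorm_nonneg _)
      _ = _ := by ring

theorem range_jacobian_le {k : ℕ} (φ : ℝ → ℝ) (v : Fin k → ℝ) (W : Matrix (Fin k) (Fin d) ℝ) :
    LinearMap.range (Matrix.toEuclideanLin (jacobian φ v W D.cleanMatrix)) ≤ D.supportSpace := by
  rintro _ ⟨x, rfl⟩ l i₁ i₂ h₁ h₂
  have hrow : jacobian φ v W D.cleanMatrix i₁ = jacobian φ v W D.cleanMatrix i₂ := by
    -- Distinct clusters may share a center here, so clean inputs are compared instead of cluster
    -- indices.
    have hc : D.cleanMatrix i₁ = D.cleanMatrix i₂ := by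
      funext q
      simp [ClusterableDataset.cleanMatrix, h₁, h₂]
    funext jl
    simp [jacobian, khatriRao, Matrix.mul_apply, hc]
  change (jacobian φ v W D.cleanMatrix *ᵥ x.ofLp) i₁ = (jacobian φ v W D.cleanMatrix *ᵥ x.ofLp) i₂
  simp [Matrix.mulVec, hrow]

/-- The rows of `C`, weighted by the derivative of the activation: the Jacobian of a single
neuron with weights `g` at the cluster centers. -/
def neuronJacobian (φ : ℝ → ℝ) (C : Matrix (Fin K) (Fin d) ℝ) (g : Fin d → ℝ) :
    Matrix (Fin K) (Fin d) ℝ :=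
  Matrix.of fun l q => deriv φ ((C *ᵥ g) l) * C l q

/-- Equality case of Cauchy-Schwarz: on a cluster where `u` is constant, the squared sum is the
cluster size times the sum of squares. -/
theorem card_mul_sum_sq_le {u : EuclideanSpace ℝ (Fin n)} (hu : u ∈ D.supportSpace) :
    cLow * n / K * ∑ i, u i ^ 2
      ≤ ∑ l, (∑ i ∈ Finset.univ.filter (fun i => D.cluster i = l), u i) ^ 2 := by
  rw [← Finset.sum_fiberwise (s := Finset.univ) (g := D.cluster), Finset.mul_sum]
  refine Finset.sum_le_sum fun l _ => ?_
  have e : (∑ i ∈ Finset.univ.filter (fun i => D.cluster i = l), u i) ^ 2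
      = ((Finset.univ.filter fun i => D.cluster i = l).card : ℝ) *
        ∑ i ∈ Finset.univ.filter (fun i => D.cluster i = l), u i ^ 2 := by
    rw [pow_two, Finset.sum_mul_sum, Finset.mul_sum]
    refine Finset.sum_congr rfl fun i hi => ?_
    rw [Finset.sum_congr rfl (g := fun _ => u i ^ 2) fun i' hi' => ?_, Finset.sum_const,
      nsmul_eq_mul]
    rw [pow_two, hu l i i' (by rw [ClusterableDataset.clean, (Finset.mem_filter.1 hi).2])
      (by rw [ClusterableDataset.clean, (Finset.mem_filter.1 hi').2])]
  rw [e, mul_div_assoc]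
  exact mul_le_mul_of_nonneg_right (D.card_lower l) (Finset.sum_nonneg fun _ _ => sq_nonneg _)

theorem sum_vecMul_jacobian_sq {k : ℕ} (φ : ℝ → ℝ) (v : Fin k → ℝ)
    (W : Matrix (Fin k) (Fin d) ℝ) (u : Fin n → ℝ) :
    ∑ jl, (u ᵥ* jacobian φ v W D.cleanMatrix) jl ^ 2 =
      ∑ j, v j ^ 2 * ∑ q, ((fun l => ∑ i ∈ Finset.univ.filter (fun i => D.cluster i = l), u i) ᵥ*
        neuronJacobian φ D.centerMatrix (W j)) q ^ 2 := by
  rw [Fintype.sum_prod_type]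
  refine Finset.sum_congr rfl fun j _ => ?_
  rw [Finset.mul_sum]
  refine Finset.sum_congr rfl fun q _ => ?_
  rw [← mul_pow]
  congr 1
  simp only [Matrix.vecMul, dotProduct, jacobian_cleanMatrix_apply, neuronJacobian, Matrix.of_apply]
  rw [← Finset.sum_fiberwise (s := Finset.univ) (g := D.cluster), Finset.mul_sum]
  refine Finset.sum_congr rfl fun l _ => ?_
  rw [Finset.sum_mul, Finset.mul_sum]
  refine Finset.sum_congr rfl fun i hi => ?_
  rw [(Finset.mem_filter.1 hi).2]
  ring

end Jacobian

/-! ### Restricted smallest singular value. -/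

section SigmaMin

variable {n : ℕ} {p : Type*} [Fintype p]

theorem exists_mul_transpose_eq_starProjection (S : Submodule ℝ (EuclideanSpace ℝ (Fin n))) :
    ∃ U : Matrix (Fin n) (Fin (Module.finrank ℝ S)) ℝ,
      Matrix.toEuclideanCLM (𝕜 := ℝ) (U * Uᵀ) = S.starProjection := by
  let b := stdOrthonormalBasis ℝ S
  refine ⟨Matrix.of fun i j => (b j : EuclideanSpace ℝ (Fin n)) i, ?_⟩
  ext x i
  rw [b.starProjection_eq_sum_rankOne]
  simp only [Matrix.ofLp_toEuclideanCLM, Matrix.mulVec, dotProduct, Matrix.mul_apply,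
    Matrix.transpose_apply, Matrix.of_apply]
  simp [PiLp.inner_apply, Finset.sum_mul]
  rw [Finset.sum_comm]
  refine Finset.sum_congr rfl fun j _ => Finset.sum_congr rfl fun q _ => ?_
  ring

/-- The Gram matrix `G = Uᵀ U` has full rank `dim S`, the rank of the projection, and idempotence of
`U Uᵀ` gives `G³ = G²`; cancel `G²`. -/
theorem transpose_mul_self_eq_one {S : Submodule ℝ (EuclideanSpace ℝ (Fin n))}
    {U : Matrix (Fin n) (Fin (Module.finrank ℝ S)) ℝ}
    (hU : Matrix.toEuclideanCLM (𝕜 := ℝ) (U * Uᵀ) = S.starProjection) : Uᵀ * U = 1 := by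
  have hidem : U * Uᵀ * (U * Uᵀ) = U * Uᵀ := by
    apply (Matrix.toEuclideanCLM (𝕜 := ℝ) (n := Fin n)).injective
    refine (map_mul (Matrix.toEuclideanCLM (𝕜 := ℝ) (n := Fin n)) _ _).trans ?_
    refine Eq.trans ?_ hU.symm
    rw [hU]
    exact S.isIdempotentElem_starProjection
  have hrank : (Uᵀ * U).rank = Module.finrank ℝ S := by
    rw [Matrix.rank_transpose_mul_self, ← Matrix.rank_self_mul_transpose,
      Matrix.rank_eq_finrank_range_toLin _ (EuclideanSpace.basisFun (Fin n) ℝ).toBasis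
        (EuclideanSpace.basisFun (Fin n) ℝ).toBasis, ← Matrix.toEuclideanLin_eq_toLin_orthonormal,
      ← Matrix.coe_toEuclideanCLM_eq_toEuclideanLin, hU]
    exact congrArg (fun T : Submodule ℝ (EuclideanSpace ℝ (Fin n)) => Module.finrank ℝ T)
      S.range_starProjection
  have hunit : IsUnit (Uᵀ * U) := by
    refine Matrix.mulVec_surjective_iff_isUnit.1 (LinearMap.range_eq_top.1 ?_ :
      Function.Surjective (Uᵀ * U).mulVecLin)
    refine Submodule.eq_top_of_finrank_eq ?_
    rw [Module.finrank_fin_fun]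
    exact hrank
  have h3 : Uᵀ * U * (Uᵀ * U) * (Uᵀ * U) = Uᵀ * U * (Uᵀ * U) := by
    have := congrArg (fun Y => Uᵀ * Y * U) hidem
    simpa only [Matrix.mul_assoc] using this
  have h4 := (hunit.mul hunit).mul_left_cancel (h3.trans (mul_one _).symm)
  exact h4

/-- As `U` has orthonormal columns spanning `S`, `U v` is a unit vector of `S`. Positive dimension
keeps the set nonempty; otherwise its `sInf` would be `0`. -/
theorem le_sigmaMinOn {M : Matrix (Fin n) p ℝ} {S : Submodule ℝ (EuclideanSpace ℝ (Fin n))}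
    {c : ℝ} (hS : 0 < Module.finrank ℝ S)
    (h : ∀ u ∈ S, ∑ i, u i ^ 2 = 1 → c ≤ √(∑ q, (u.ofLp ᵥ* M) q ^ 2)) : c ≤ sigmaMinOn M S := by
  refine le_csInf ?_ ?_
  · obtain ⟨U, hU⟩ := exists_mul_transpose_eq_starProjection S
    exact ⟨_, U, EuclideanSpace.single ⟨0, hS⟩ 1, hU, by simp, rfl⟩
  · rintro r ⟨U, v, hU, hv, rfl⟩
    have h1 := transpose_mul_self_eq_one hU
    have hmem : WithLp.toLp 2 (U *ᵥ v.ofLp) ∈ S := by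
      rw [← Submodule.starProjection_eq_self_iff, ← hU]
      ext i
      rw [Matrix.ofLp_toEuclideanCLM, Matrix.mulVec_mulVec, Matrix.mul_assoc, h1, Matrix.mul_one]
    have hn : ∑ i, (WithLp.toLp 2 (U *ᵥ v.ofLp) : EuclideanSpace ℝ (Fin n)) i ^ 2 = 1 := by
      have e : ∑ i, (U *ᵥ v.ofLp) i ^ 2 = (U *ᵥ v.ofLp) ⬝ᵥ (U *ᵥ v.ofLp) := by
        simp [dotProduct, pow_two]
      have e2 : v.ofLp ⬝ᵥ v.ofLp = ‖v‖ ^ 2 := by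
        rw [EuclideanSpace.real_norm_sq_eq]
        simp [dotProduct, pow_two]
      refine e.trans ?_
      rw [Matrix.dotProduct_mulVec, Matrix.vecMul_mulVec, ← Matrix.dotProduct_mulVec, h1,
        Matrix.one_mulVec, e2, hv, one_pow]
    refine (h _ hmem hn).trans_eq ?_
    rw [EuclideanSpace.norm_eq]
    congr 1
    refine Finset.sum_congr rfl fun q _ => ?_
    rw [Real.norm_eq_abs, sq_abs, ← Matrix.vecMul_vecMul, Matrix.vecMul_transpose]

end SigmaMin

/-! ### The Gram matrix of one random neuron. -/

section NeuronGram

variable {d K : ℕ} {φ : ℝ → ℝ} {C : Matrix (Fin K) (Fin d) ℝ} {Γ : ℝ}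

theorem neuronJacobian_gram_apply (g : Fin d → ℝ) (l l' : Fin K) :
    (neuronJacobian φ C g * (neuronJacobian φ C g)ᵀ) l l' =
      (C * Cᵀ) l l' * (deriv φ ((C *ᵥ g) l) * deriv φ ((C *ᵥ g) l')) := by
  simp only [neuronJacobian, Matrix.mul_apply, Matrix.transpose_apply, Matrix.of_apply,
    Finset.sum_mul]
  exact Finset.sum_congr rfl fun q _ => by ring

theorem dotProduct_gram_mulVec {m p : Type*} [Fintype m] [Fintype p] (F : Matrix m p ℝ)
    (x : m → ℝ) : x ⬝ᵥ ((F * Fᵀ) *ᵥ x) = ∑ q, (x ᵥ* F) q ^ 2 := by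
  rw [← Matrix.mulVec_mulVec, Matrix.dotProduct_mulVec, Matrix.mulVec_transpose]
  simp [dotProduct, pow_two]

/-- The vector is `Cᵀ` applied to `x` rescaled entrywise by values of `φ'`. -/
theorem sum_vecMul_neuronJacobian_sq_le (hφ : ∀ z, |deriv φ z| ≤ Γ) (g : Fin d → ℝ)
    (x : Fin K → ℝ) :
    ∑ q, (x ᵥ* neuronJacobian φ C g) q ^ 2 ≤ Γ ^ 2 * specNorm C ^ 2 * ∑ l, x l ^ 2 := by
  have h := sum_mulVec_sq_le Cᵀ fun l => deriv φ ((C *ᵥ g) l) * x l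
  have e : ∀ q, (Cᵀ *ᵥ fun l => deriv φ ((C *ᵥ g) l) * x l) q
      = (x ᵥ* neuronJacobian φ C g) q := fun q => by
    simp only [neuronJacobian, Matrix.mulVec, Matrix.vecMul, dotProduct, Matrix.transpose_apply,
      Matrix.of_apply]
    exact Finset.sum_congr rfl fun l _ => by ring
  simp_rw [e, specNorm_transpose] at h
  refine h.trans ?_
  rw [mul_comm (Γ ^ 2), mul_assoc]
  refine mul_le_mul_of_nonneg_left ?_ (sq_nonneg _)
  rw [Finset.mul_sum]
  refine Finset.sum_le_sum fun l _ => ?_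
  rw [mul_pow]
  exact mul_le_mul_of_nonneg_right (sq_le_sq' (abs_le.1 (hφ _)).1 (abs_le.1 (hφ _)).2)
    (sq_nonneg _)

theorem posSemidef_gram (F : Matrix (Fin K) (Fin d) ℝ) : (F * Fᵀ).PosSemidef := by
  simpa using Matrix.posSemidef_self_mul_conjTranspose F

theorem posSemidef_bound_sub_gram (hφ : ∀ z, |deriv φ z| ≤ Γ) (g : Fin d → ℝ) :
    ((Γ ^ 2 * specNorm C ^ 2) • (1 : Matrix (Fin K) (Fin K) ℝ) -
      neuronJacobian φ C g * (neuronJacobian φ C g)ᵀ).PosSemidef := by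
  refine Matrix.PosSemidef.of_dotProduct_mulVec_nonneg
    ((Matrix.PosSemidef.one.smul (by positivity)).1.sub (posSemidef_gram _).1) fun x => ?_
  have h := sum_vecMul_neuronJacobian_sq_le (C := C) hφ g x
  have e : x ⬝ᵥ x = ∑ l, x l ^ 2 := by simp [dotProduct, pow_two]
  rw [star_trivial, Matrix.sub_mulVec, dotProduct_sub, dotProduct_gram_mulVec, Matrix.smul_mulVec,
    Matrix.one_mulVec, dotProduct_smul, smul_eq_mul, e]
  linarith

theorem continuous_gram (hd : Continuous (deriv φ)) :
    Continuous fun g => neuronJacobian φ C g * (neuronJacobian φ C g)ᵀ := by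
  refine continuous_matrix fun l l' => ?_
  simp_rw [neuronJacobian_gram_apply]
  have h : ∀ l, Continuous fun g : Fin d → ℝ => deriv φ ((C *ᵥ g) l) := fun l =>
    hd.comp ((continuous_apply l).comp (continuous_const.matrix_mulVec continuous_id))
  exact continuous_const.mul ((h l).mul (h l'))

theorem integrable_gram {μ : Measure (Fin d → ℝ)} [IsProbabilityMeasure μ]
    (hd : Continuous (deriv φ)) (hφ : ∀ z, |deriv φ z| ≤ Γ) (l l' : Fin K) :
    Integrable (fun g => (neuronJacobian φ C g * (neuronJacobian φ C g)ᵀ) l l') μ := by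
  refine Integrable.of_bound (C := |(C * Cᵀ) l l'| * (Γ * Γ))
    ((continuous_gram hd).matrix_elem l l').aestronglyMeasurable
    (Filter.Eventually.of_forall fun g => ?_)
  rw [neuronJacobian_gram_apply, Real.norm_eq_abs, abs_mul, abs_mul]
  have := (abs_nonneg _).trans (hφ 0)
  gcongr <;> exact hφ _

theorem integral_gram_eq_netCov :
    (Matrix.of fun l l' => ∫ g, (neuronJacobian φ C g * (neuronJacobian φ C g)ᵀ) l l'
      ∂(Measure.pi fun _ : Fin d => gaussianReal 0 1)) = netCov φ C := by
  ext l l'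
  simp_rw [Matrix.of_apply, neuronJacobian_gram_apply]
  rw [integral_const_mul]
  rfl

theorem posSemidef_netCov_sub_lam : (netCov φ C - lam φ C • (1 : Matrix _ _ ℝ)).PosSemidef :=
  posSemidef_sub_smul_one (netCov_isHermitian φ C) fun i =>
    ciInf_le (Set.finite_range _).bddBelow i

/-- Compare diagonal entries. This makes the Chernoff bound's `B` positive and forces `k` to be
large. -/
theorem lam_le_bound (hd : Continuous (deriv φ)) (hφ : ∀ z, |deriv φ z| ≤ Γ) (l : Fin K) :
    lam φ C ≤ Γ ^ 2 * specNorm C ^ 2 := by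
  have h1 := (posSemidef_netCov_sub_lam (φ := φ) (C := C)).diag_nonneg (i := l)
  rw [Matrix.sub_apply, Matrix.smul_apply, Matrix.one_apply_eq, smul_eq_mul, mul_one,
    ← integral_gram_eq_netCov, Matrix.of_apply] at h1
  have h2 : ∫ g, (neuronJacobian φ C g * (neuronJacobian φ C g)ᵀ) l l
      ∂(Measure.pi fun _ : Fin d => gaussianReal 0 1) ≤ ∫ _, Γ ^ 2 * specNorm C ^ 2
        ∂(Measure.pi fun _ : Fin d => gaussianReal 0 1) := by
    refine integral_mono (integrable_gram hd hφ l l) (integrable_const _) fun g => ?_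
    have h := (posSemidef_bound_sub_gram (C := C) hφ g).diag_nonneg (i := l)
    rw [Matrix.sub_apply, Matrix.smul_apply, Matrix.one_apply_eq, smul_eq_mul, mul_one] at h
    linarith
  rw [integral_const, probReal_univ, one_smul] at h2
  linarith

end NeuronGram

/-! ### The high-probability lower bound. -/

section SmallestSingularValue

variable {n d K Kbar k : ℕ} {ε₀ δ cLow cUp : ℝ}
  (D : ClusterableDataset n d K Kbar ε₀ δ cLow cUp)

theorem finrank_supportSpace_pos (hn : 0 < n) : 0 < Module.finrank ℝ D.supportSpace := by
  have hmem : (WithLp.toLp 2 fun _ => 1 : EuclideanSpace ℝ (Fin n)) ∈ D.supportSpace :=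
    fun _ _ _ _ _ => rfl
  have : Nontrivial D.supportSpace := by
    refine ⟨⟨⟨_, hmem⟩, 0, fun h => ?_⟩⟩
    have h1 := congrArg (fun u : D.supportSpace => (u : EuclideanSpace ℝ (Fin n)) ⟨0, hn⟩) h
    simp at h1
  exact Module.finrank_pos

theorem le_sigmaMinOn_jacobian (φ : ℝ → ℝ) (v : Fin k → ℝ) (W : Matrix (Fin k) (Fin d) ℝ)
    {lo : ℝ} (hlo : 0 ≤ lo) (hk : 0 < k)
    (h : (∑ j, ((k : ℝ) * v j ^ 2) • (neuronJacobian φ D.centerMatrix (W j) *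
        (neuronJacobian φ D.centerMatrix (W j))ᵀ) -
      (k * lo / 2) • (1 : Matrix (Fin K) (Fin K) ℝ)).PosSemidef) :
    √(cLow * n * lo / (2 * K)) ≤ sigmaMinOn (jacobian φ v W D.cleanMatrix) D.supportSpace := by
  rcases Nat.eq_zero_or_pos n with rfl | hn
  -- Without data points the left side is `0`, and an infimum of norms is nonnegative.
  · rw [Nat.cast_zero, mul_zero, zero_mul, zero_div, Real.sqrt_zero]
    refine Real.sInf_nonneg ?_
    rintro r ⟨U, w, -, -, rfl⟩
    exact norm_nonneg _
  · refine le_sigmaMinOn (finrank_supportSpace_pos D hn) fun u hu hu1 => Real.sqrt_le_sqrt ?_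
    rw [sum_vecMul_jacobian_sq]
    set b : Fin K → ℝ := fun l => ∑ i ∈ Finset.univ.filter (fun i => D.cluster i = l), u i with hb
    have hk0 : (0 : ℝ) < k := by exact_mod_cast hk
    have h1 := h.dotProduct_mulVec_nonneg b
    have e : b ⬝ᵥ b = ∑ l, b l ^ 2 := by simp [dotProduct, pow_two]
    rw [star_trivial, Matrix.sub_mulVec, dotProduct_sub, Matrix.sum_mulVec, dotProduct_sum,
      Matrix.smul_mulVec, Matrix.one_mulVec, dotProduct_smul, smul_eq_mul, e] at h1
    simp_rw [Matrix.smul_mulVec, dotProduct_smul, dotProduct_gram_mulVec, smul_eq_mul, mul_assoc]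
      at h1
    rw [← Finset.mul_sum] at h1
    have h2 := card_mul_sum_sq_le D hu
    rw [hu1, mul_one] at h2
    have h3 : lo / 2 * ∑ l, b l ^ 2 ≤
        ∑ j, v j ^ 2 * ∑ q, (b ᵥ* neuronJacobian φ D.centerMatrix (W j)) q ^ 2 := by
      refine le_of_mul_le_mul_left ?_ hk0
      linarith
    refine le_trans ?_ h3
    calc cLow * n * lo / (2 * K) = lo / 2 * (cLow * n / K) := by
          rw [div_mul_div_comm, mul_comm lo]
      _ ≤ _ := mul_le_mul_of_nonneg_left h2 (by positivity)

theorem measure_le_sigmaMinOn_jacobian {φ : ℝ → ℝ} {v : Fin k → ℝ} {Γ : ℝ}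
    (hv : IsOutputWeights v) (hd : Continuous (deriv φ)) (hφ : ∀ z, |deriv φ z| ≤ Γ)
    (hlam : 0 < lam φ D.centerMatrix)
    (hk : 2500 * Γ ^ 2 * Real.log K * specNorm D.centerMatrix ^ 2 / lam φ D.centerMatrix ≤ k) :
    1 - 1 / (K : ℝ) ^ 100 ≤ (gaussianInit k d).real
      {W | √(cLow * n * lam φ D.centerMatrix / (2 * K)) ≤
        sigmaMinOn (jacobian φ v (Matrix.of W) D.cleanMatrix) D.supportSpace} := by
  -- `log K` is useless here: `K = 0` makes `lam` an empty infimum, hence `0`, and for `K = 1` the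
  -- claimed probability is `0`.
  rcases Nat.lt_or_ge K 2 with hK | hK
  · refine le_trans ?_ measureReal_nonneg
    interval_cases K
    · have : lam φ D.centerMatrix = 0 := Real.iInf_of_isEmpty _
      linarith
    · norm_num
  have hK2 : (2 : ℝ) ≤ K := by exact_mod_cast hK
  set lo := lam φ D.centerMatrix with hlo
  set B := Γ ^ 2 * specNorm D.centerMatrix ^ 2 with hB
  have hloB : lo ≤ B := lam_le_bound hd hφ ⟨0, by omega⟩
  have hB0 : 0 < B := hlam.trans_le hloB
  have hlog2 : Real.log 2 ≤ Real.log K := Real.log_le_log two_pos hK2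
  have hlog := Real.log_two_gt_d9
  have hkB : 2500 * Real.log K * B ≤ k * lo := by
    rw [div_le_iff₀ hlam] at hk
    refine le_of_eq_of_le ?_ hk
    rw [hB]; ring
  have hk10 : (10 : ℝ) ≤ k := by
    by_contra! hcon
    nlinarith
  have hk0 : 0 < k := by
    have : (0 : ℝ) < k := by linarith
    exact_mod_cast this
  have ha : ∀ j, (k : ℝ) * v j ^ 2 = 0 ∨ (k : ℝ) * v j ^ 2 = 1 := fun j => by
    rw [hv.mul_sq_eq]
    split_ifs <;> simp
  have hsum : (k : ℝ) - 1 ≤ ∑ j, (k : ℝ) * v j ^ 2 := by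
    rw [hv.sum_mul_sq]
    have : ((k % 2 : ℕ) : ℝ) ≤ 1 := by exact_mod_cast (by omega : k % 2 ≤ 1)
    linarith
  have hch := matrix_chernoff_lower (μ := Measure.pi fun _ : Fin d => gaussianReal 0 1)
    (H := fun g => neuronJacobian φ D.centerMatrix g * (neuronJacobian φ D.centerMatrix g)ᵀ)
    (lo := lo) (s := 1 / 5) (t := k * lo / 2) hB0 (by norm_num) (by norm_num) (continuous_gram hd)
    (fun g => posSemidef_gram _) (fun g => posSemidef_bound_sub_gram hφ g)
    (integrable_gram hd hφ) (by rw [integral_gram_eq_netCov]; exact posSemidef_netCov_sub_lam) ha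
  have hexp : (Fintype.card (Fin K) : ℝ) * Real.exp (1 / 5 / B *
      (k * lo / 2 - (∑ j, (k : ℝ) * v j ^ 2) * ((1 - 1 / 5) * lo))) ≤ 1 / (K : ℝ) ^ 100 := by
    have hK0 : (0 : ℝ) < K := by linarith
    -- At least `k - 1` neurons are active, so the exponent is at most `-(0.3 k - 0.8) lo / (5 B)`.
    -- With `k ≥ 10` this is at most `-0.044 k lo / B ≤ -110 log K`, which is where `2500` enters.
    -- The target `101` leaves one power of `K` for the dimension factor.
    have h1 : 1 / 5 / B * (k * lo / 2 - (∑ j, (k : ℝ) * v j ^ 2) * ((1 - 1 / 5) * lo))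
        ≤ -(101 * Real.log K) := by
      rw [div_mul_eq_mul_div, div_le_iff₀ hB0]
      have h2 := mul_le_mul_of_nonneg_right hsum hlam.le
      have h3 := mul_le_mul_of_nonneg_right hk10 hlam.le
      have h4 : 0 < Real.log K * B := mul_pos (by linarith) hB0
      nlinarith
    have h5 : Real.exp (-(101 * Real.log K)) = ((K : ℝ) ^ 101)⁻¹ := by
      rw [Real.exp_neg, mul_comm, Real.exp_mul, Real.exp_log hK0]
      norm_cast
    rw [Fintype.card_fin]
    refine (mul_le_mul_of_nonneg_left (Real.exp_le_exp.2 h1) hK0.le).trans_eq ?_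
    rw [h5]
    field_simp
  refine le_trans (by linarith) (hch.trans (measureReal_mono fun W hW => ?_))
  exact le_sigmaMinOn_jacobian D φ v (Matrix.of W) hlam.le hk0 hW

end SmallestSingularValue

end ClusterNet

end

theorem mainTheorem9 :
    ∃ c : ℝ, 0 < c ∧
      ∀ (n d K Kbar k : ℕ) (ε₀ δ cLow cUp Γ : ℝ)
        (D : ClusterNet.ClusterableDataset n d K Kbar ε₀ δ cLow cUp)
        (φ : ℝ → ℝ) (v : Fin k → ℝ),
        ClusterNet.IsOutputWeights v →
        Differentiable ℝ φ → Differentiable ℝ (deriv φ) →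
        (∀ z, |deriv φ z| ≤ Γ) → (∀ z, |deriv (deriv φ) z| ≤ Γ) →
        0 < ClusterNet.lam φ D.centerMatrix →
        (∀ W' W : Matrix (Fin k) (Fin d) ℝ,
          ClusterNet.specNorm (ClusterNet.jacobian φ v W' D.cleanMatrix
              - ClusterNet.jacobian φ v W D.cleanMatrix) ≤
            Γ * √(cUp * n / (k * K)) * ClusterNet.specNorm D.centerMatrix
              * ClusterNet.frobNorm (W' - W)) ∧
        (∀ W : Matrix (Fin k) (Fin d) ℝ,
          ClusterNet.specNorm (ClusterNet.jacobian φ v W D.cleanMatrix) ≤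
            √(cUp * n / K) * Γ * ClusterNet.specNorm D.centerMatrix) ∧
        (c * Γ ^ 2 * Real.log K * ClusterNet.specNorm D.centerMatrix ^ 2
              / ClusterNet.lam φ D.centerMatrix ≤ k →
          1 - 1 / (K : ℝ) ^ 100 ≤
            (ClusterNet.gaussianInit k d).real
              {W | √(cLow * n * ClusterNet.lam φ D.centerMatrix / (2 * K)) ≤
                ClusterNet.sigmaMinOn
                  (ClusterNet.jacobian φ v (Matrix.of W) D.cleanMatrix) D.supportSpace}) ∧
        (∀ W : Matrix (Fin k) (Fin d) ℝ,
          LinearMap.range (Matrix.toEuclideanLin (ClusterNet.jacobian φ v W D.cleanMatrix)) ≤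
            D.supportSpace) := by
  refine ⟨2500, by norm_num, ?_⟩
  intro n d K Kbar k ε₀ δ cLow cUp Γ D φ v hv _ hd hφ hφ' hlam
  exact ⟨ClusterNet.specNorm_jacobian_sub_le D hv hd hφ',
    ClusterNet.specNorm_jacobian_le D hv hφ,
    ClusterNet.measure_le_sigmaMinOn_jacobian D hv hd.continuous hφ hlam,
    ClusterNet.range_jacobian_le D φ v⟩
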